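/- For real $x$ and $k\in\mathbb{Z}$ let $(x)_k=\Gamma(x+k)/\Gamma(x)$, that is, $(x)_k=x(x+1)\cdots(x+k-1)$ for $k\ge 0$ and $(x)_k=(-1)^k/(1-x)_{-k}$ for $k<0$, and let $${}_3F_2(a_1,a_2,a_3;b_1,b_2;x)=\sum_{k=0}^{\infty}\frac{(a_1)_k(a_2)_k(a_3)_k}{(b_1)_k(b_2)_k\,k!}\,x^k .$$ Theorem. Let $l$ be a nonnegative integer, $r$ an integer and $c$ a real number such that $c<r-l$, or $c\le r-l$ if $c$ is a nonpositive integer. Let $a,b$ be arbitrary real numbers for which the series on the left-hand side below is well defined: neither $a-l$ nor $b+1$ is a nonpositive integer or, if $c=-n$ with an integer $n\ge 0$ (so that the series stops at $k=n$), neither of them lies in $\{0,-1,\dots,-(n-1)\}$. Then the series converges and $${}_3F_2(a,\,b-r,\,c;\;a-l,\,b+1;\;1)=\frac{(-1)^l\,\Gamma(1-c)\,\Gamma(1+b)\,(a-c-l)_r\,(1-b)_r}{\Gamma(1+b-c)\,(1-a)_l\,(a-b)_{r-l}\;r!}\;{}_3F_2(-r,\,1-a,\,c-b;\;1-b,\,1-a+c+l-r;\;1),$$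 where $1/r!=0$ for $r<0$ and $1/\Gamma$ is $0$ at the poles of $\Gamma$. If the right-hand side is indeterminate at $(a,b,c)$ (one of $1-c$, $1+b$ is a pole of $\Gamma$, $(1-a)_l=0$, $r\ge l$ and $(a-b)_{r-l}=0$, or a bottom Pochhammer symbol of its ${}_3F_2$ vanishes before the sum has terminated), then it is understood as its limit along the determinate parameters $(a',b',c')\to(a,b,c)$ (with $c'=c$ if $c$ is a nonpositive integer); such parameters exist arbitrarily close to $(a,b,c)$, and the limit exists. In particular, both sides are zero if $r<0$. -/

import Mathlib

open Filter Topology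

/-- The Pochhammer symbol `(x)_k = Γ(x + k) / Γ(x)` for an integer `k` of either sign:
`(x)_k = x (x + 1) ⋯ (x + k - 1)` for `k ≥ 0` and `(x)_k = (-1)^k / (1 - x)_{-k}` for `k < 0`.
If `k < 0` and `(1 - x)_{-k} = 0`, then `(x)_k` is a pole; the value returned is `0`, whose
inverse `0` is the correct value of `1 / (x)_k = (-1)^k (1 - x)_{-k}`. -/
noncomputable def poch (x : ℝ) : ℤ → ℝ
  | Int.ofNat n => (ascPochhammer ℝ n).eval x
  | Int.negSucc n => (-1) ^ (n + 1) / (ascPochhammer ℝ (n + 1)).eval (1 - x)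

/-- The `k`-th term of the series `₃F₂(a₁, a₂, a₃; b₁, b₂; x)`. -/
noncomputable def hyp32Term (a₁ a₂ a₃ b₁ b₂ x : ℝ) (k : ℕ) : ℝ :=
  poch a₁ k * poch a₂ k * poch a₃ k / (poch b₁ k * poch b₂ k * (k.factorial : ℝ)) * x ^ k

/-- The generalized hypergeometric function `₃F₂(a₁, a₂, a₃; b₁, b₂; x)`, as the sum of its
series. -/
noncomputable def hyp32 (a₁ a₂ a₃ b₁ b₂ x : ℝ) : ℝ :=
  ∑' k : ℕ, hyp32Term a₁ a₂ a₃ b₁ b₂ x k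

/-- The right-hand side of the summation formula. Here `Γ(r + 1)` is `r!`. Since `Real.Gamma`
takes the value `0` at its poles, the factors `1 / Γ(1 + b - c)` and `1 / r!` (equal to `0` for
`r < 0`) have their usual values. -/
noncomputable def thomaeRhs (l : ℕ) (r : ℤ) (a b c : ℝ) : ℝ :=
  (-1) ^ l * Real.Gamma (1 - c) * Real.Gamma (1 + b) * poch (a - c - l) r * poch (1 - b) r /
      (Real.Gamma (1 + b - c) * poch (1 - a) l * poch (a - b) (r - l) * Real.Gamma (r + 1)) *
    hyp32 (-r) (1 - a) (c - b) (1 - b) (1 - a + c + l - r) 1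

/-- The parameters at which no indeterminacy occurs on the right-hand side: `1 - c` and `1 + b`
are not poles of the gamma function, the Pochhammer symbols in the denominator of the factor do
not vanish (for `r < l` the reciprocal `1 / (a - b)_{r - l}` is always finite), and no bottom
Pochhammer symbol of the hypergeometric sum vanishes before the sum has terminated. -/
def RhsRegular (l : ℕ) (r : ℤ) (a b c : ℝ) : Prop :=
  (∀ n : ℕ, 1 - c ≠ -(n : ℝ)) ∧
  (∀ n : ℕ, 1 + b ≠ -(n : ℝ)) ∧
  poch (1 - a) l ≠ 0 ∧
  (0 ≤ r - l → poch (a - b) (r - l) ≠ 0) ∧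
  ∀ k : ℕ, poch (-r) k * poch (1 - a) k * poch (c - b) k ≠ 0 →
    poch (1 - b) k ≠ 0 ∧ poch (1 - a + c + l - r) k ≠ 0

/-- The parameters through which `(a, b, c)` is approached when the right-hand side is
indeterminate at `(a, b, c)`: those at which it is determinate; if the left-hand series terminates
because `c` is a nonpositive integer, then `c` is kept fixed. -/
def regularApproach (l : ℕ) (r : ℤ) (c : ℝ) : Set (ℝ × ℝ × ℝ) :=
  {p | RhsRegular l r p.1 p.2.1 p.2.2 ∧ ((∃ n : ℕ, c = -(n : ℝ)) → p.2.2 = c)}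

/-! The quotient `(a)_k / (a - l)_k = (a - l + k)_l / (a - l)_l` is a polynomial in `k` of degree at
most `l`. Chu–Vandermonde expands it in the products `(b - r + k)_i`, and `(b - r)_k (b - r + k)_i =
(b - r)_i (b - r + i)_k`. The left-hand series thus becomes a combination of `l + 1` series `₂F₁(c,
b - r + i; b + 1; 1)`, each summed by Gauss's theorem (`hasSum_gaussTerm`); the result is
`gaussExpansion`.

The factors `1 / Γ(r + 1 - i)` kill everything when `r < 0` and cut the sum at `i ≤ r` otherwise.
For `r = n ≥ 0` what remains is a coefficient of `(1 - z)^l ₂F₁(a - b, 1 - c; 1 - b; z)`. Euler's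
transformation (`euler_transform`) turns it into the same coefficient of `(1 - z)^(c + l - a) ₂F₁(1
- a, c - b; 1 - b; z)`, which is the right-hand side with denominators cleared.

At indeterminate points the limit is found on the left: `gaussExpansion` is continuous, or, for `c =
-n`, the series is a finite sum continuous in `a` and `b`. -/

open Finset.HasAntidiagonal (antidiagonal)

/-! ### Rising factorials -/

/-- The rising factorial `x (x + 1) ⋯ (x + n - 1)`. -/
noncomputable def rise (x : ℝ) (n : ℕ) : ℝ := (ascPochhammer ℝ n).eval x

lemma poch_natCast (x : ℝ) (n : ℕ) : poch x n = rise x n := rfl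

@[simp] lemma rise_zero (x : ℝ) : rise x 0 = 1 := by simp [rise]

lemma rise_succ (x : ℝ) (n : ℕ) : rise x (n + 1) = rise x n * (x + n) :=
  ascPochhammer_succ_eval n x

lemma rise_add (x : ℝ) (m n : ℕ) : rise x (m + n) = rise x m * rise (x + m) n := by
  induction n with
  | zero => simp
  | succ n ih =>
    rw [← add_assoc, rise_succ, ih, rise_succ]
    push_cast
    ring

lemma rise_succ_left (x : ℝ) (n : ℕ) : rise x (n + 1) = x * rise (x + 1) n := by
  rw [add_comm, rise_add]
  simp [rise]

lemma rise_eq_zero_iff (x : ℝ) (n : ℕ) : rise x n = 0 ↔ ∃ i < n, (i : ℝ) = -x :=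
  ascPochhammer_eval_eq_zero_iff n x

lemma continuous_rise (n : ℕ) : Continuous fun x => rise x n :=
  (ascPochhammer ℝ n).continuous

lemma rise_reflect (x : ℝ) (n : ℕ) : rise x n = (-1) ^ n * rise (1 - x - n) n := by
  induction n generalizing x with
  | zero => simp
  | succ n ih =>
    rw [rise_succ, ih, rise_succ_left]
    have : 1 - x - ((n + 1 : ℕ) : ℝ) + 1 = 1 - x - n := by push_cast; ring
    rw [this]
    push_cast
    ring

/-- Factors of a rising factorial counted from the top. -/
lemma rise_eq_mul_reflect (x : ℝ) {k n : ℕ} (h : k ≤ n) :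
    rise x n = rise x (n - k) * ((-1) ^ k * rise (1 - x - n) k) := by
  obtain ⟨d, rfl⟩ := Nat.exists_eq_add_of_le' h
  rw [Nat.add_sub_cancel, rise_add, rise_reflect (x + d) k]
  congr 3
  push_cast
  ring

lemma rise_neg_natCast (n k : ℕ) : rise (-n) k = (-1) ^ k * n.descFactorial k := by
  rw [rise, ascPochhammer_eval_neg_eq_descPochhammer, descPochhammer_eval_eq_descFactorial]

/-! ### Terminating summations and Euler's transformation -/

/-- The Chu–Vandermonde identity for rising factorials. -/
lemma rise_add_left (x y : ℝ) (n : ℕ) :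
    rise (x + y) n = ∑ p ∈ antidiagonal n, (n.choose p.1 : ℝ) * (rise x p.1 * rise y p.2) := by
  induction n with
  | zero => simp
  | succ n ih =>
    rw [Finset.sum_antidiagonal_choose_succ_mul fun i j => rise x i * rise y j, rise_succ, ih,
      Finset.sum_mul, ← Finset.sum_add_distrib]
    refine Finset.sum_congr rfl fun p hp => ?_
    have hp' := Finset.HasAntidiagonal.mem_antidiagonal.1 hp
    rw [← hp', ← Nat.choose_symm_add, rise_succ, rise_succ]
    push_cast
    ring

/-- The Pfaff–Saalschütz identity, with denominators cleared. -/
lemma saalschutz (A B e : ℝ) (n : ℕ) :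
    ∑ p ∈ antidiagonal n, (n.choose p.1 : ℝ) *
      (rise A p.1 * rise B p.1 * rise (e + p.1) p.2 * rise (e - A - B) p.2) =
    rise (e - A) n * rise (e - B) n := by
  induction n with
  | zero => simp
  | succ n ih =>
    rw [Finset.sum_antidiagonal_choose_succ_mul fun i j =>
      rise A i * rise B i * rise (e + i) j * rise (e - A - B) j, rise_succ, rise_succ]
    -- Here `(e + i + 1)_j - (e + i)_j = j (e + i + 1)_{j - 1}`, and `C(n, i) (n - i) = C(n, i + 1)
    -- (i + 1)` moves the index by one.
    have shift : ∑ p ∈ antidiagonal n, (n.choose p.1 : ℝ) * p.1 *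
          (rise A p.1 * rise B p.1 * rise (e + p.1) p.2 * rise (e - A - B) (p.2 + 1)) =
        ∑ p ∈ antidiagonal n, (n.choose p.1 : ℝ) *
          (rise A (p.1 + 1) * rise B (p.1 + 1) *
            (rise (e + (p.1 + 1 : ℕ)) p.2 - rise (e + p.1) p.2) * rise (e - A - B) p.2) := by
      cases n with
      | zero => simp
      | succ n =>
        rw [Finset.Nat.sum_antidiagonal_succ, Finset.Nat.sum_antidiagonal_succ']
        simp only [Nat.cast_zero, mul_zero, zero_mul, zero_add, rise_zero, sub_self, add_zero]
        refine Finset.sum_congr rfl fun p hp => ?_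
        have hp' := Finset.HasAntidiagonal.mem_antidiagonal.1 hp
        have hch : ((n + 1).choose (p.1 + 1) : ℝ) * (p.1 + 1 : ℕ) =
            (n + 1).choose p.1 * (p.2 + 1 : ℕ) := by
          have := Nat.choose_succ_right_eq (n + 1) p.1
          rw [show n + 1 - p.1 = p.2 + 1 by omega] at this
          exact_mod_cast this
        rw [hch, rise_succ (e + (p.1 + 1 : ℕ)), rise_succ_left (e + p.1)]
        have : e + (p.1 : ℝ) + 1 = e + (p.1 + 1 : ℕ) := by push_cast; ring
        rw [this]
        push_cast
        ring
    -- The defect in the recurrence from `n` to `n + 1`, computed termwise; by `shift` its two sums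
    -- cancel.
    have key : ∑ p ∈ antidiagonal n, (n.choose p.1 : ℝ) *
          (rise A p.1 * rise B p.1 * rise (e + p.1) (p.2 + 1) * rise (e - A - B) (p.2 + 1)) +
        ∑ p ∈ antidiagonal n, (n.choose p.1 : ℝ) * (rise A (p.1 + 1) * rise B (p.1 + 1) *
          rise (e + (p.1 + 1 : ℕ)) p.2 * rise (e - A - B) p.2) -
        (e - A + n) * (e - B + n) * ∑ p ∈ antidiagonal n, (n.choose p.1 : ℝ) *
          (rise A p.1 * rise B p.1 * rise (e + p.1) p.2 * rise (e - A - B) p.2) =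
        ∑ p ∈ antidiagonal n, (n.choose p.1 : ℝ) *
          (rise A (p.1 + 1) * rise B (p.1 + 1) *
            (rise (e + (p.1 + 1 : ℕ)) p.2 - rise (e + p.1) p.2) * rise (e - A - B) p.2) -
        ∑ p ∈ antidiagonal n, (n.choose p.1 : ℝ) * p.1 *
          (rise A p.1 * rise B p.1 * rise (e + p.1) p.2 * rise (e - A - B) (p.2 + 1)) := by
      rw [Finset.mul_sum, ← Finset.sum_add_distrib, ← Finset.sum_sub_distrib,
        ← Finset.sum_sub_distrib]
      refine Finset.sum_congr rfl fun p hp => ?_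
      have hp' := Finset.HasAntidiagonal.mem_antidiagonal.1 hp
      have hn : (n : ℝ) = p.1 + p.2 := by exact_mod_cast hp'.symm
      rw [hn, rise_succ A, rise_succ B, rise_succ (e + p.1), rise_succ (e - A - B)]
      ring
    rw [shift, sub_self, ih] at key
    have hsymm : ∑ p ∈ antidiagonal n, (n.choose p.2 : ℝ) * (rise A (p.1 + 1) * rise B (p.1 + 1) *
          rise (e + (p.1 + 1 : ℕ)) p.2 * rise (e - A - B) p.2) =
        ∑ p ∈ antidiagonal n, (n.choose p.1 : ℝ) * (rise A (p.1 + 1) * rise B (p.1 + 1) *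
          rise (e + (p.1 + 1 : ℕ)) p.2 * rise (e - A - B) p.2) := by
      refine Finset.sum_congr rfl fun p hp => ?_
      rw [← Finset.HasAntidiagonal.mem_antidiagonal.1 hp, ← Nat.choose_symm_add]
    rw [hsymm]
    linear_combination key

/-- Coefficient form of Euler's transformation
`₂F₁(A, B; e; z) = (1 - z) ^ (e - A - B) ₂F₁(e - A, e - B; e; z)`. -/
lemma euler_transform (A B e D : ℝ) (n : ℕ) :
    ∑ p ∈ antidiagonal n, (n.choose p.1 : ℝ) *
      (rise (e - A) p.1 * rise (e - B) p.1 * rise (e + p.1) p.2 * rise (D + A + B - e) p.2) =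
    ∑ p ∈ antidiagonal n, (n.choose p.1 : ℝ) *
      (rise A p.1 * rise B p.1 * rise (e + p.1) p.2 * rise D p.2) := by
  have h1 : ∑ p ∈ antidiagonal n, (n.choose p.1 : ℝ) *
      (rise (e - A) p.1 * rise (e - B) p.1 * rise (e + p.1) p.2 * rise (D + A + B - e) p.2) =
      ∑ p ∈ antidiagonal n, ∑ q ∈ antidiagonal p.1, (n.choose p.1 : ℝ) * (p.1.choose q.1) *
        (rise A q.1 * rise B q.1 * rise (e + q.1) (q.2 + p.2) * rise (e - A - B) q.2 *
          rise (D + A + B - e) p.2) := by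
    refine Finset.sum_congr rfl fun p _ => ?_
    rw [← saalschutz, Finset.sum_mul, Finset.sum_mul, Finset.mul_sum]
    refine Finset.sum_congr rfl fun q hq => ?_
    rw [rise_add, ← Finset.HasAntidiagonal.mem_antidiagonal.1 hq]
    rw [Nat.cast_add, ← add_assoc]
    ring
  have h2 : ∑ p ∈ antidiagonal n, (n.choose p.1 : ℝ) *
      (rise A p.1 * rise B p.1 * rise (e + p.1) p.2 * rise D p.2) =
      ∑ p ∈ antidiagonal n, ∑ q ∈ antidiagonal p.2, (n.choose p.1 : ℝ) * (p.2.choose q.1) *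
        (rise A p.1 * rise B p.1 * rise (e + p.1) (q.1 + q.2) * rise (e - A - B) q.1 *
          rise (D + A + B - e) q.2) := by
    refine Finset.sum_congr rfl fun p _ => ?_
    have hD := rise_add_left (e - A - B) (D + A + B - e) p.2
    rw [show e - A - B + (D + A + B - e) = D by ring] at hD
    rw [hD, Finset.mul_sum, Finset.mul_sum]
    refine Finset.sum_congr rfl fun q hq => ?_
    rw [Finset.HasAntidiagonal.mem_antidiagonal.1 hq]
    ring
  -- Both double sums run over triples with sum `n`, with the same multinomial weight; only the
  -- grouping differs.
  rw [h1, h2, Finset.sum_sigma', Finset.sum_sigma']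
  refine Finset.sum_nbij' (fun x => ⟨(x.2.1, x.2.2 + x.1.2), (x.2.2, x.1.2)⟩)
    (fun x => ⟨(x.1.1 + x.2.1, x.2.2), (x.1.1, x.2.1)⟩) ?_ ?_ ?_ ?_ ?_
  · rintro ⟨⟨i, j⟩, k, m⟩ h
    simp only [Finset.mem_sigma, Finset.HasAntidiagonal.mem_antidiagonal, and_true] at h ⊢
    omega
  · rintro ⟨⟨i, j⟩, k, m⟩ h
    simp only [Finset.mem_sigma, Finset.HasAntidiagonal.mem_antidiagonal, and_true] at h ⊢
    omega
  · rintro ⟨⟨i, j⟩, k, m⟩ h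
    simp only [Finset.mem_sigma, Finset.HasAntidiagonal.mem_antidiagonal] at h
    obtain ⟨h, rfl⟩ := h
    rfl
  · rintro ⟨⟨i, j⟩, k, m⟩ h
    simp only [Finset.mem_sigma, Finset.HasAntidiagonal.mem_antidiagonal] at h
    obtain ⟨h, rfl⟩ := h
    rfl
  · rintro ⟨⟨i, j⟩, k, m⟩ h
    simp only [Finset.mem_sigma, Finset.HasAntidiagonal.mem_antidiagonal] at h
    obtain ⟨rfl, rfl⟩ := h
    have : ((k + m + j).choose (k + m) : ℝ) * (k + m).choose k =
        (k + m + j).choose k * (m + j).choose m := by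
      have := Nat.choose_mul (n := k + m + j) (k := k + m) (s := k) (by omega)
      rw [show k + m + j - k = m + j by omega, show k + m - k = m by omega] at this
      exact_mod_cast this
    dsimp only
    rw [this]

/-! ### Growth of rising factorials and the gamma function -/

lemma rise_pos {x : ℝ} (hx : 0 < x) (n : ℕ) : 0 < rise x n := ascPochhammer_pos n x hx

lemma rise_le_rise {x y : ℝ} (hx : 0 < x) (hxy : x ≤ y) (n : ℕ) : rise x n ≤ rise y n := by
  induction n with
  | zero => simp
  | succ n ih =>
    rw [rise_succ, rise_succ]
    exact mul_le_mul ih (by linarith) (by positivity) (rise_pos (hx.trans_le hxy) n).le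

lemma rise_ne_zero {x : ℝ} (hx : ∀ m : ℕ, x ≠ -m) (n : ℕ) : rise x n ≠ 0 := by
  rw [Ne, rise_eq_zero_iff]
  rintro ⟨i, -, hi⟩
  exact hx i (by linarith)

lemma prod_range_add_eq_rise (x : ℝ) (n : ℕ) : ∏ j ∈ Finset.range n, (x + j) = rise x n := by
  induction n with
  | zero => simp
  | succ n ih => rw [Finset.prod_range_succ, ih, rise_succ]

lemma Gamma_add_natCast {x : ℝ} (hx : ∀ m : ℕ, x ≠ -m) (n : ℕ) :
    Real.Gamma (x + n) = Real.Gamma x * rise x n := by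
  induction n with
  | zero => simp
  | succ n ih =>
    have h : x + n ≠ 0 := fun h => hx n (by linarith)
    rw [Nat.cast_succ, ← add_assoc, Real.Gamma_add_one h, ih, rise_succ]
    ring

/-- The rising factorial `(x)_{n+1}` divided by its growth rate `n ^ x n!`. -/
noncomputable def riseRatio (x : ℝ) (n : ℕ) : ℝ := rise x (n + 1) / ((n : ℝ) ^ x * n.factorial)

lemma rise_succ_eq_riseRatio (x : ℝ) {n : ℕ} (hn : n ≠ 0) :
    rise x (n + 1) = riseRatio x n * ((n : ℝ) ^ x * n.factorial) := by
  have : (n : ℝ) ^ x ≠ 0 := (Real.rpow_pos_of_pos (by positivity) x).ne'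
  rw [riseRatio, div_mul_cancel₀]
  positivity

lemma tendsto_riseRatio (x : ℝ) : Tendsto (riseRatio x) atTop (𝓝 (Real.Gamma x)⁻¹) := by
  have heq : riseRatio x = fun n => (Real.GammaSeq x n)⁻¹ := by
    ext n
    rw [Real.GammaSeq, inv_div, prod_range_add_eq_rise, riseRatio]
  -- `Real.Gamma` vanishes exactly at the poles `-m`, where the factor `x + m` makes the ratio
  -- eventually zero.
  by_cases hx : Real.Gamma x = 0
  · obtain ⟨m, hm⟩ := (Real.Gamma_eq_zero_iff x).1 hx
    rw [hx, inv_zero]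
    refine tendsto_const_nhds.congr' ?_
    filter_upwards [eventually_ge_atTop m] with n hn
    rw [riseRatio, (rise_eq_zero_iff x (n + 1)).2 ⟨m, by omega, by linarith⟩, zero_div]
  · rw [heq]
    exact (Real.GammaSeq_tendsto_Gamma x).inv₀ hx

/-! ### Gauss's summation theorem -/

/-- The `k`-th term of the series `₂F₁(α, β; γ; 1)`. -/
noncomputable def gaussTerm (α β γ : ℝ) (k : ℕ) : ℝ :=
  rise α k * rise β k / (rise γ k * k.factorial)

lemma gaussTerm_succ_eq (α β γ : ℝ) {n : ℕ} (hn : n ≠ 0) :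
    gaussTerm α β γ (n + 1) =
      riseRatio α n * riseRatio β n / riseRatio γ n * (n : ℝ) ^ (α + β - γ) / (n + 1) := by
  have hn' : (0 : ℝ) < n := by positivity
  have hf : (n.factorial : ℝ) ≠ 0 := by positivity
  have hγ : (n : ℝ) ^ γ ≠ 0 := (Real.rpow_pos_of_pos hn' γ).ne'
  rw [gaussTerm, rise_succ_eq_riseRatio α hn, rise_succ_eq_riseRatio β hn,
    rise_succ_eq_riseRatio γ hn, Real.rpow_sub hn', Real.rpow_add hn', Nat.factorial_succ]
  push_cast
  by_cases h : riseRatio γ n = 0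
  · simp [h]
  · field_simp

section Gauss

variable {α β γ : ℝ}

lemma tendsto_gaussRatio (hγ : ∀ m : ℕ, γ ≠ -m) :
    ∃ L, Tendsto (fun n => riseRatio α n * riseRatio β n / riseRatio γ n) atTop (𝓝 L) :=
  ⟨_, ((tendsto_riseRatio α).mul (tendsto_riseRatio β)).div (tendsto_riseRatio γ)
    (inv_ne_zero (Real.Gamma_ne_zero hγ))⟩

lemma summable_gaussTerm (hγ : ∀ m : ℕ, γ ≠ -m) (h : 0 < γ - α - β) :
    Summable (gaussTerm α β γ) := by
  rw [← summable_nat_add_iff 1]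
  obtain ⟨L, hL⟩ := tendsto_gaussRatio (α := α) (β := β) hγ
  refine summable_of_isBigO_nat (g := fun n : ℕ => (n : ℝ) ^ (α + β - γ - 1))
    (Real.summable_nat_rpow.2 (by linarith)) ?_
  have h1 := hL.isBigO_one ℝ
  have h2 : (fun n : ℕ => (n : ℝ) ^ (α + β - γ) / (n + 1)) =O[atTop]
      fun n : ℕ => (n : ℝ) ^ (α + β - γ - 1) := by
    refine Asymptotics.IsBigO.of_bound 1 ?_
    filter_upwards [eventually_gt_atTop 0] with n hn
    have hn' : (0 : ℝ) < n := by exact_mod_cast hn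
    have hp := Real.rpow_pos_of_pos hn' (α + β - γ)
    rw [Real.rpow_sub_one hn'.ne', Real.norm_of_nonneg (by positivity),
      Real.norm_of_nonneg (by positivity), one_mul]
    gcongr
    linarith
  refine ((h1.mul h2).congr' ?_ ?_)
  · filter_upwards [eventually_ne_atTop 0] with n hn
    rw [gaussTerm_succ_eq α β γ hn]
    ring
  · exact .of_eq (by simp)

lemma tendsto_natCast_mul_gaussTerm (hγ : ∀ m : ℕ, γ ≠ -m) (h : 0 < γ - α - β) :
    Tendsto (fun n : ℕ => n * gaussTerm α β γ n) atTop (𝓝 0) := by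
  rw [← tendsto_add_atTop_iff_nat 1]
  obtain ⟨L, hL⟩ := tendsto_gaussRatio (α := α) (β := β) hγ
  have h0 : Tendsto (fun n : ℕ => (n : ℝ) ^ (α + β - γ)) atTop (𝓝 0) := by
    have := (tendsto_rpow_neg_atTop h).comp tendsto_natCast_atTop_atTop
    refine this.congr fun n => ?_
    simp only [Function.comp]
    congr 1
    ring
  have := hL.mul h0
  rw [mul_zero] at this
  refine this.congr' ?_
  filter_upwards [eventually_ne_atTop 0] with n hn
  rw [gaussTerm_succ_eq α β γ hn]
  push_cast
  field_simp

/-- The right-hand side telescopes, so summation over `k` relates the values at `γ` and `γ + 1`. -/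
lemma gaussTerm_contiguous (hγ : ∀ m : ℕ, γ ≠ -m) (k : ℕ) :
    γ * (γ - α - β) * gaussTerm α β γ k - (γ - α) * (γ - β) * gaussTerm α β (γ + 1) k =
      γ * (k * gaussTerm α β γ k - (k + 1 : ℕ) * gaussTerm α β γ (k + 1)) := by
  have h0 : γ ≠ 0 := by simpa using hγ 0
  have hk : γ + k ≠ 0 := fun h => hγ k (by linarith)
  have hr : rise γ k ≠ 0 := rise_ne_zero hγ k
  have hshift : rise (γ + 1) k = rise γ k * (γ + k) / γ := by
    rw [← rise_succ, rise_succ_left, mul_div_cancel_left₀ _ h0]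
  have hf : (k.factorial : ℝ) ≠ 0 := by positivity
  simp only [gaussTerm]
  rw [hshift, rise_succ, rise_succ, rise_succ, Nat.factorial_succ]
  push_cast
  field_simp
  ring

lemma tsum_gaussTerm_contiguous (hγ : ∀ m : ℕ, γ ≠ -m) (h : 0 < γ - α - β) :
    γ * (γ - α - β) * ∑' k, gaussTerm α β γ k =
      (γ - α) * (γ - β) * ∑' k, gaussTerm α β (γ + 1) k := by
  have hγ' : ∀ m : ℕ, γ + 1 ≠ -m := fun m hm => hγ (m + 1) (by push_cast; linarith)
  have h1 := ((summable_gaussTerm hγ h).hasSum.mul_left (γ * (γ - α - β))).sub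
    ((summable_gaussTerm (α := α) (β := β) hγ' (by linarith)).hasSum.mul_left
      ((γ - α) * (γ - β)))
  have h2 := h1.tendsto_sum_nat
  simp only [gaussTerm_contiguous hγ, ← Finset.mul_sum] at h2
  simp only [Finset.sum_range_sub' fun k : ℕ => (k : ℝ) * gaussTerm α β γ k] at h2
  have h3 := ((tendsto_natCast_mul_gaussTerm hγ h).const_sub
    (((0 : ℕ) : ℝ) * gaussTerm α β γ 0)).const_mul γ
  have := tendsto_nhds_unique h2 h3
  simp only [Nat.cast_zero, zero_mul, sub_zero, mul_zero] at this
  linarith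

lemma tsum_gaussTerm_shift (hγ : ∀ m : ℕ, γ ≠ -m) (h : 0 < γ - α - β) (N : ℕ) :
    rise γ N * rise (γ - α - β) N * ∑' k, gaussTerm α β γ k =
      rise (γ - α) N * rise (γ - β) N * ∑' k, gaussTerm α β (γ + N) k := by
  induction N with
  | zero => simp
  | succ N ih =>
    have hγ' : ∀ m : ℕ, γ + N ≠ -m := fun m hm => hγ (m + N) (by push_cast; linarith)
    have hN : (0 : ℝ) ≤ N := N.cast_nonneg
    have hc := tsum_gaussTerm_contiguous (α := α) (β := β) hγ' (by linarith)
    rw [Nat.cast_succ, ← add_assoc]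
    simp only [rise_succ]
    linear_combination (γ + N) * (γ - α - β + N) * ih + rise (γ - α) N * rise (γ - β) N * hc

/-- Every term with `k ≥ 1` tends to `0`, and once `γ + N₀ > 0` the terms at `γ + N₀` dominate all
later ones. -/
lemma tendsto_tsum_gaussTerm_shift (h : 0 < γ - α - β) :
    Tendsto (fun N : ℕ => ∑' k, gaussTerm α β (γ + N) k) atTop (𝓝 1) := by
  obtain ⟨N₀, hN₀⟩ := exists_nat_gt (-γ)
  have hpos : 0 < γ + N₀ := by linarith
  have hs : Summable (gaussTerm α β (γ + N₀)) := by
    have : (0 : ℝ) ≤ N₀ := N₀.cast_nonneg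
    refine summable_gaussTerm (fun m hm => ?_) (by linarith)
    have : (0 : ℝ) ≤ m := m.cast_nonneg
    linarith
  have h1 : ∑' k : ℕ, (if k = 0 then (1 : ℝ) else 0) = 1 := by simp
  rw [← h1]
  refine tendsto_tsum_of_dominated_convergence hs.norm (fun k => ?_) ?_
  · cases k with
    | zero => simp [gaussTerm]
    | succ k =>
      simp only [Nat.succ_ne_zero, if_false, gaussTerm]
      refine Tendsto.div_atTop tendsto_const_nhds ?_
      refine Tendsto.atTop_mul_const (by positivity) ?_
      refine tendsto_atTop_mono' atTop (f₁ := fun N : ℕ => γ + N) ?_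
        (tendsto_atTop_add_const_left _ _ tendsto_natCast_atTop_atTop)
      filter_upwards [eventually_ge_atTop N₀] with N hN
      have hle : γ + N₀ ≤ γ + N := by gcongr
      rw [rise_succ_left]
      refine le_mul_of_one_le_right (by linarith) ?_
      calc (1 : ℝ) ≤ k.factorial := by exact_mod_cast k.factorial_pos
        _ = rise 1 k := Nat.cast_factorial ℝ k
        _ ≤ _ := rise_le_rise one_pos (by linarith) k
  · filter_upwards [eventually_ge_atTop N₀] with N hN k
    have hle : γ + N₀ ≤ γ + N := by gcongr
    have hr := rise_le_rise hpos hle k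
    have hp := rise_pos hpos k
    have hp' := hp.trans_le hr
    have hf : (0 : ℝ) < k.factorial := by positivity
    simp only [gaussTerm, norm_div, norm_mul, Real.norm_of_nonneg hp.le,
      Real.norm_of_nonneg hp'.le, Real.norm_of_nonneg hf.le]
    gcongr

/-- Gauss's summation theorem for `₂F₁(α, β; γ; 1)`. -/
theorem hasSum_gaussTerm (hγ : ∀ m : ℕ, γ ≠ -m) (h : 0 < γ - α - β) :
    HasSum (gaussTerm α β γ) (Real.Gamma γ * Real.Gamma (γ - α - β) /
      (Real.Gamma (γ - α) * Real.Gamma (γ - β))) := by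
  have hs := summable_gaussTerm hγ h
  convert hs.hasSum using 1
  have hΓ : Real.Gamma γ ≠ 0 := Real.Gamma_ne_zero hγ
  have hΓ' : Real.Gamma (γ - α - β) ≠ 0 := (Real.Gamma_pos_of_pos h).ne'
  have h1 : Tendsto (fun n => riseRatio γ n * riseRatio (γ - α - β) n * ∑' k, gaussTerm α β γ k)
      atTop (𝓝 ((Real.Gamma γ)⁻¹ * (Real.Gamma (γ - α - β))⁻¹ * ∑' k, gaussTerm α β γ k)) :=
    ((tendsto_riseRatio _).mul (tendsto_riseRatio _)).mul_const _
  have h2 : Tendsto (fun n => riseRatio (γ - α) n * riseRatio (γ - β) n *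
      ∑' k, gaussTerm α β (γ + (n + 1 : ℕ)) k)
      atTop (𝓝 ((Real.Gamma (γ - α))⁻¹ * (Real.Gamma (γ - β))⁻¹ * 1)) :=
    ((tendsto_riseRatio _).mul (tendsto_riseRatio _)).mul
      ((tendsto_tsum_gaussTerm_shift h).comp (tendsto_add_atTop_nat 1))
  have h3 := tendsto_nhds_unique_of_eventuallyEq h1 h2 ?_
  · field_simp at h3
    rw [h3]
  · filter_upwards [eventually_ne_atTop 0] with n hn
    have hn' : (0 : ℝ) < n := by positivity
    have key := tsum_gaussTerm_shift hγ h (n + 1)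
    simp only [rise_succ_eq_riseRatio _ hn] at key
    -- The growth rates on the two sides of `key` agree, so they cancel and leave only the ratios
    -- with limits `1 / Γ`.
    have hpow : (n : ℝ) ^ γ * (n : ℝ) ^ (γ - α - β) = (n : ℝ) ^ (γ - α) * (n : ℝ) ^ (γ - β) := by
      rw [← Real.rpow_add hn', ← Real.rpow_add hn']
      congr 1
      ring
    have hp : (n : ℝ) ^ (γ - α) * (n : ℝ) ^ (γ - β) ≠ 0 :=
      (mul_pos (Real.rpow_pos_of_pos hn' _) (Real.rpow_pos_of_pos hn' _)).ne'
    have hf : (n.factorial : ℝ) ^ 2 ≠ 0 := by positivity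
    refine mul_right_cancel₀ (mul_ne_zero hp hf) ?_
    linear_combination key - (n.factorial : ℝ) ^ 2 * riseRatio γ n * riseRatio (γ - α - β) n *
      (∑' k, gaussTerm α β γ k) * hpow

end Gauss

/-! ### Summation of the left-hand series -/

/-- The left-hand series summed by Gauss's theorem after a Chu–Vandermonde expansion of
`(a)_k / (a - l)_k`. -/
noncomputable def gaussExpansion (l : ℕ) (r : ℤ) (a b c : ℝ) : ℝ :=
  (rise (a - l) l)⁻¹ * ∑ p ∈ antidiagonal l,
    (l.choose p.1 * (rise (b - r) p.1 * rise (a - b + r - l) p.2)) *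
      (Real.Gamma (b + 1) * Real.Gamma (b + 1 - c - (b - r + p.1)) /
        (Real.Gamma (b + 1 - c) * Real.Gamma (b + 1 - (b - r + p.1))))

lemma hyp32Term_eq_sum_gaussTerm {l : ℕ} {r : ℤ} {a b c : ℝ} (ha : rise (a - l) l ≠ 0)
    (hdef : ∀ k, rise c k ≠ 0 → rise (a - l) k ≠ 0) (k : ℕ) :
    hyp32Term a (b - r) c (a - l) (b + 1) 1 k = (rise (a - l) l)⁻¹ * ∑ p ∈ antidiagonal l,
      (l.choose p.1 * (rise (b - r) p.1 * rise (a - b + r - l) p.2)) *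
        gaussTerm c (b - r + p.1) (b + 1) k := by
  simp only [hyp32Term, poch_natCast, gaussTerm, one_pow, mul_one]
  by_cases hck : rise c k = 0
  · simp [hck]
  have hak := hdef k hck
  have h1 : rise a k * rise (a - l) l = rise (a - l) k * rise (a - l + k) l := by
    rw [← rise_add, add_comm k l, rise_add, sub_add_cancel, mul_comm]
  have h2 : rise a k / rise (a - l) k = (rise (a - l) l)⁻¹ * rise (a - l + k) l := by
    field_simp
    linarith
  have h3 := rise_add_left (b - r + k) (a - b + r - l) l
  rw [show b - r + k + (a - b + r - l) = a - l + k by ring] at h3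
  calc rise a k * rise (b - r) k * rise c k / (rise (a - l) k * rise (b + 1) k * k.factorial)
      = rise a k / rise (a - l) k *
          (rise (b - r) k * rise c k / (rise (b + 1) k * k.factorial)) := by
        rw [div_mul_div_comm]
        ring
    _ = _ := by
        rw [h2, h3, mul_assoc, Finset.sum_mul]
        congr 1
        refine Finset.sum_congr rfl fun p _ => ?_
        have h4 : rise (b - r) k * rise (b - r + k) p.1 =
            rise (b - r) p.1 * rise (b - r + p.1) k := by
          rw [← rise_add, ← rise_add, add_comm]
        linear_combination (l.choose p.1 * rise (a - b + r - l) p.2 * rise c k /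
          (rise (b + 1) k * k.factorial)) * h4

lemma hasSum_hyp32Term {l : ℕ} {r : ℤ} {a b c : ℝ} (ha : rise (a - l) l ≠ 0)
    (hb : ∀ m : ℕ, b + 1 ≠ -m) (hc : c < r - l + 1)
    (hdef : ∀ k, rise c k ≠ 0 → rise (a - l) k ≠ 0) :
    HasSum (hyp32Term a (b - r) c (a - l) (b + 1) 1) (gaussExpansion l r a b c) := by
  rw [funext (hyp32Term_eq_sum_gaussTerm ha hdef)]
  refine HasSum.mul_left _ (hasSum_sum fun p hp => HasSum.mul_left _ (hasSum_gaussTerm hb ?_))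
  have : (p.1 : ℝ) ≤ l := by
    exact_mod_cast Finset.HasAntidiagonal.mem_antidiagonal.1 hp ▸ Nat.le_add_right _ _
  linarith

/-! ### Reduction to the right-hand side -/

/-- Covers both signs of `n - l`. For `n < l` no hypothesis is needed: at a pole `poch` returns `0`,
whose inverse is the true value of the reciprocal. -/
lemma inv_poch_mul_rise (x : ℝ) {l n i : ℕ} (hl : i ≤ l) (hn : i ≤ n)
    (h : l ≤ n → poch x (n - l) ≠ 0) :
    (poch x (n - l))⁻¹ * rise x (n - i) = rise (x + n - l) (l - i) := by
  rcases le_or_gt l n with hln | hln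
  · obtain ⟨d, rfl⟩ := Nat.exists_eq_add_of_le hln
    have hd : ((l + d : ℕ) : ℤ) - l = d := by push_cast; ring
    rw [hd, poch_natCast] at h ⊢
    rw [show l + d - i = d + (l - i) by omega, rise_add, inv_mul_cancel_left₀ (h hln)]
    congr 1
    push_cast
    ring
  · obtain ⟨d, rfl⟩ := Nat.exists_eq_add_of_lt hln
    have hd : (n : ℤ) - (n + d + 1 : ℕ) = Int.negSucc d := by
      rw [Int.negSucc_eq]
      push_cast
      ring
    have hx : x + n - (n + d + 1 : ℕ) = x - (d + 1 : ℕ) := by push_cast; ring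
    rw [hd, hx, show n + d + 1 - i = d + 1 + (n - i) by omega, rise_add, sub_add_cancel,
      rise_reflect (x - (d + 1 : ℕ))]
    have hy : 1 - (x - (d + 1 : ℕ)) - (d + 1 : ℕ) = 1 - x := by ring
    rw [hy]
    change ((-1) ^ (d + 1) / rise (1 - x) (d + 1))⁻¹ * _ = _
    rw [inv_div, div_eq_mul_inv, ← inv_pow, inv_neg, inv_one]
    ring

/-- The prefactors `(a - c - l)_n` and `(1 - b)_n` clear the two bottom symbols, the first after
reversing its order of factors. -/
lemma rise_mul_rise_mul_hyp32 {l n : ℕ} {a b c : ℝ}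
    (hreg : ∀ k : ℕ, rise (-n) k * rise (1 - a) k * rise (c - b) k ≠ 0 →
      rise (1 - b) k ≠ 0 ∧ rise (1 - a + c + l - n) k ≠ 0) :
    rise (a - c - l) n * rise (1 - b) n * hyp32 (-n) (1 - a) (c - b) (1 - b) (1 - a + c + l - n) 1 =
      ∑ p ∈ antidiagonal n, (n.choose p.1 : ℝ) * (rise (1 - a) p.1 * rise (c - b) p.1 *
        rise (1 - b + p.1) p.2 * rise (a - c - l) p.2) := by
  have hsum : hyp32 (-n) (1 - a) (c - b) (1 - b) (1 - a + c + l - n) 1 =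
      ∑ k ∈ Finset.range (n + 1), hyp32Term (-n) (1 - a) (c - b) (1 - b) (1 - a + c + l - n) 1 k := by
    refine tsum_eq_sum fun k hk => ?_
    have hk' : n < k := by
      have := mt Finset.mem_range.2 hk
      omega
    simp [hyp32Term, poch_natCast, rise_neg_natCast, Nat.descFactorial_of_lt hk']
  rw [hsum, ← Finset.Nat.sum_antidiagonal_eq_sum_range_succ_mk
    (fun p : ℕ × ℕ => hyp32Term (-n) (1 - a) (c - b) (1 - b) (1 - a + c + l - n) 1 p.1),
    Finset.mul_sum]
  refine Finset.sum_congr rfl fun p hp => ?_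
  have hp' := Finset.HasAntidiagonal.mem_antidiagonal.1 hp
  simp only [hyp32Term, poch_natCast, one_pow, mul_one]
  -- Past termination the bottom symbols may vanish. As `(-n)_i ≠ 0` for `i ≤ n`, one of the other
  -- top symbols is zero, and both sides vanish.
  by_cases h0 : rise (-n) p.1 * rise (1 - a) p.1 * rise (c - b) p.1 = 0
  · have hn : rise (-n : ℝ) p.1 ≠ 0 := by
      rw [rise_neg_natCast]
      refine mul_ne_zero (pow_ne_zero _ (by norm_num)) ?_
      exact_mod_cast (Nat.descFactorial_pos.2 (by omega : p.1 ≤ n)).ne'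
    rw [mul_assoc, mul_eq_zero, or_iff_right hn] at h0
    rw [mul_assoc (rise (-n : ℝ) p.1), h0]
    simp
  · obtain ⟨h1, h2⟩ := hreg p.1 h0
    have e1 : rise (1 - b) n = rise (1 - b) p.1 * rise (1 - b + p.1) p.2 := by
      rw [← rise_add, hp']
    have e2 : rise (a - c - l) n =
        rise (a - c - l) p.2 * ((-1) ^ p.1 * rise (1 - a + c + l - n) p.1) := by
      rw [rise_eq_mul_reflect (a - c - l) (by omega : p.1 ≤ n), show n - p.1 = p.2 by omega]
      congr 3
      ring
    have hf : (p.1.factorial : ℝ) ≠ 0 := by positivity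
    have e3 : rise (-n : ℝ) p.1 = (-1) ^ p.1 * (p.1.factorial * n.choose p.1) := by
      rw [rise_neg_natCast, Nat.descFactorial_eq_factorial_mul_choose]
      push_cast
      ring
    have e4 : ((-1 : ℝ) ^ p.1) * (-1) ^ p.1 = 1 := by rw [← mul_pow]; simp
    rw [e1, e2, e3]
    field_simp
    rw [pow_two, e4, mul_one]

lemma sum_antidiagonal_gamma_eq {l n : ℕ} {a b c : ℝ} (hc : ∀ m : ℕ, 1 - c ≠ -m)
    (hpoch : l ≤ n → poch (a - b) (n - l) ≠ 0) :
    ∑ p ∈ antidiagonal l, (l.choose p.1 * (rise (b - n) p.1 * rise (a - b + n - l) p.2)) *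
        (Real.Gamma (n + 1 - p.1 - c) / Real.Gamma (n + 1 - p.1)) =
      Real.Gamma (1 - c) * (poch (a - b) (n - l))⁻¹ / n.factorial *
        ∑ p ∈ antidiagonal n, (n.choose p.1 : ℝ) * (rise (a - b) p.1 * rise (1 - c) p.1 *
          rise (1 - b + p.1) p.2 * rise (-l) p.2) := by
  rw [← Finset.Nat.sum_antidiagonal_swap (n := n), Finset.Nat.sum_antidiagonal_eq_sum_range_succ_mk,
    Finset.Nat.sum_antidiagonal_eq_sum_range_succ_mk, Finset.mul_sum]
  simp only [Prod.swap]
  -- Only `i ≤ min l n` contributes: `1 / Γ(n + 1 - i) = 0` for `i > n` on the left, `(-l)_i = 0`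
  -- for `i > l` on the right.
  rw [← Finset.sum_subset (Finset.range_mono (by omega : min l n + 1 ≤ l + 1)),
    ← Finset.sum_subset (Finset.range_mono (by omega : min l n + 1 ≤ n + 1))]
  · refine Finset.sum_congr rfl fun i hi => ?_
    have hil : i ≤ l := by have := Finset.mem_range.1 hi; omega
    have hin : i ≤ n := by have := Finset.mem_range.1 hi; omega
    rw [← inv_poch_mul_rise (a - b) hil hin hpoch, Nat.choose_symm hin]
    have hcast : ((n - i : ℕ) : ℝ) = n - i := Nat.cast_sub hin
    have g1 : Real.Gamma (n + 1 - i - c) = Real.Gamma (1 - c) * rise (1 - c) (n - i) := by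
      rw [← Gamma_add_natCast hc, hcast]
      congr 1
      ring
    have g2 : Real.Gamma (n + 1 - i) = (n - i).factorial := by
      rw [← Real.Gamma_nat_eq_factorial, hcast]
      congr 1
      ring
    have g3 : rise (b - n) i = (-1) ^ i * rise (1 - b + (n - i : ℕ)) i := by
      rw [rise_reflect, hcast]
      congr 2
      ring
    have g4 : (n.choose i : ℝ) = n.factorial / (i.factorial * (n - i).factorial) :=
      Nat.cast_choose ℝ hin
    have g5 : rise (-l : ℝ) i = (-1) ^ i * (i.factorial * l.choose i) := by
      rw [rise_neg_natCast, Nat.descFactorial_eq_factorial_mul_choose]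
      push_cast
      ring
    have h1 : (n.factorial : ℝ) ≠ 0 := by positivity
    have h2 : (i.factorial : ℝ) ≠ 0 := by positivity
    have h3 : ((n - i).factorial : ℝ) ≠ 0 := by positivity
    rw [g1, g2, g3, g4, g5]
    generalize (poch (a - b) (n - l))⁻¹ = q
    field_simp
  · intro i hi hi'
    have h : l < i := by
      have h1 := Finset.mem_range.1 hi
      have h2 := mt Finset.mem_range.2 hi'
      omega
    rw [rise_neg_natCast, Nat.descFactorial_of_lt h]
    simp
  · intro i hi hi'
    have h : n < i := by
      have h1 := Finset.mem_range.1 hi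
      have h2 := mt Finset.mem_range.2 hi'
      omega
    obtain ⟨d, rfl⟩ := Nat.exists_eq_add_of_lt h
    have : (n : ℝ) + 1 - (n + d + 1 : ℕ) = -d := by push_cast; ring
    rw [this, Real.Gamma_neg_nat_eq_zero]
    simp

lemma thomaeRhs_of_neg {l : ℕ} {r : ℤ} (hr : r < 0) (a b c : ℝ) : thomaeRhs l r a b c = 0 := by
  obtain ⟨n, rfl⟩ := Int.eq_negSucc_of_lt_zero hr
  have : ((Int.negSucc n : ℤ) : ℝ) + 1 = -n := by
    rw [Int.negSucc_eq]
    push_cast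
    ring
  rw [thomaeRhs, this, Real.Gamma_neg_nat_eq_zero]
  simp

lemma gaussExpansion_eq_thomaeRhs {l : ℕ} {r : ℤ} {a b c : ℝ} (h : RhsRegular l r a b c) :
    gaussExpansion l r a b c = thomaeRhs l r a b c := by
  obtain ⟨hc, -, -, hab, hreg⟩ := h
  have hgam : gaussExpansion l r a b c = (rise (a - l) l)⁻¹ * Real.Gamma (1 + b) /
      Real.Gamma (1 + b - c) * ∑ p ∈ antidiagonal l,
        (l.choose p.1 * (rise (b - r) p.1 * rise (a - b + r - l) p.2)) *
          (Real.Gamma (r + 1 - p.1 - c) / Real.Gamma (r + 1 - p.1)) := by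
    rw [gaussExpansion, Finset.mul_sum, Finset.mul_sum]
    refine Finset.sum_congr rfl fun p _ => ?_
    rw [show b + 1 - c - (b - r + p.1) = r + 1 - p.1 - c by ring,
      show b + 1 - (b - r + p.1) = r + 1 - p.1 by ring, add_comm b 1]
    ring
  rcases lt_or_ge r 0 with hr | hr
  · rw [thomaeRhs_of_neg hr, hgam, mul_eq_zero]
    right
    refine Finset.sum_eq_zero fun p _ => ?_
    obtain ⟨n, rfl⟩ := Int.eq_negSucc_of_lt_zero hr
    have : ((Int.negSucc n : ℤ) : ℝ) + 1 - (p.1 : ℝ) = -((n + p.1 : ℕ) : ℝ) := by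
      rw [Int.negSucc_eq]
      push_cast
      ring
    rw [this, Real.Gamma_neg_nat_eq_zero]
    simp
  · obtain ⟨n, rfl⟩ := Int.eq_ofNat_of_zero_le hr
    simp only [Int.cast_natCast, poch_natCast] at hgam hreg
    rw [hgam, sum_antidiagonal_gamma_eq hc fun hln => hab (by omega), thomaeRhs]
    simp only [Int.cast_natCast, poch_natCast, Real.Gamma_nat_eq_factorial]
    have hS := rise_mul_rise_mul_hyp32 hreg
    -- The parameters are chosen so that `e - A = 1 - a`, `e - B = c - b` and `D + A + B - e = a - c
    -- - l`.
    have hE := euler_transform (a - b) (1 - c) (1 - b) (-l) n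
    rw [show 1 - b - (a - b) = 1 - a by ring, show 1 - b - (1 - c) = c - b by ring,
      show -(l : ℝ) + (a - b) + (1 - c) - (1 - b) = a - c - l by ring, ← hS] at hE
    rw [← hE, rise_reflect (a - l), show 1 - (a - l) - (l : ℝ) = 1 - a by ring, mul_inv, ← inv_pow,
      inv_neg, inv_one]
    simp only [div_eq_mul_inv, mul_inv]
    ring

/-! ### Continuity and approach through determinate parameters -/

lemma continuous_inv_Gamma : Continuous fun x : ℝ => (Real.Gamma x)⁻¹ := by
  have h := Complex.continuous_re.comp
    (Complex.differentiable_one_div_Gamma.continuous.comp Complex.continuous_ofReal)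
  refine h.congr fun x => ?_
  simp only [Function.comp]
  rw [Complex.Gamma_ofReal, ← Complex.ofReal_inv, Complex.ofReal_re]

lemma continuousAt_Gamma_of_ne {x : ℝ} (hx : ∀ m : ℕ, x ≠ -m) : ContinuousAt Real.Gamma x :=
  (Real.differentiableAt_Gamma hx).continuousAt

/-- Since `1 / Γ` is continuous everywhere, only the numerators matter: `b + 1` avoids the poles,
and the other argument is `r + 1 - i - c > 0`. -/
lemma continuousAt_gaussExpansion {l : ℕ} {r : ℤ} {a b c : ℝ} (ha : rise (a - l) l ≠ 0)
    (hb : ∀ m : ℕ, b + 1 ≠ -m) (hc : c < r - l + 1) :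
    ContinuousAt (fun p : ℝ × ℝ × ℝ => gaussExpansion l r p.1 p.2.1 p.2.2) (a, b, c) := by
  have hrise (n : ℕ) {f : ℝ × ℝ × ℝ → ℝ} (hf : Continuous f) :
      ContinuousAt (fun p => rise (f p) n) (a, b, c) :=
    ((continuous_rise n).comp hf).continuousAt
  have hinv {f : ℝ × ℝ × ℝ → ℝ} (hf : Continuous f) :
      ContinuousAt (fun p => (Real.Gamma (f p))⁻¹) (a, b, c) :=
    (continuous_inv_Gamma.comp hf).continuousAt
  simp only [gaussExpansion, div_eq_mul_inv, mul_inv]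
  refine ContinuousAt.mul ((hrise l (by fun_prop)).inv₀ ha) ?_
  refine tendsto_finsetSum _ fun p hp => ?_
  have hpl : (p.1 : ℝ) ≤ l := by
    exact_mod_cast Finset.HasAntidiagonal.mem_antidiagonal.1 hp ▸ Nat.le_add_right _ _
  refine ContinuousAt.mul (continuousAt_const.mul
    ((hrise _ (by fun_prop)).mul (hrise _ (by fun_prop)))) (ContinuousAt.mul (ContinuousAt.mul ?_ ?_)
      ((hinv (by fun_prop)).mul (hinv (by fun_prop))))
  · exact ContinuousAt.comp (f := fun q : ℝ × ℝ × ℝ => q.2.1 + 1) (g := Real.Gamma)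
      (continuousAt_Gamma_of_ne hb) (by fun_prop)
  · refine ContinuousAt.comp
      (f := fun q : ℝ × ℝ × ℝ => q.2.1 + 1 - q.2.2 - (q.2.1 - r + p.1)) (g := Real.Gamma)
      (continuousAt_Gamma_of_ne fun m hm => ?_) (by fun_prop)
    have : (0 : ℝ) ≤ m := m.cast_nonneg
    dsimp only at hm
    linarith

lemma rise_ne_zero_of_forall_int {x : ℝ} (hx : ∀ m : ℤ, x ≠ m) (n : ℕ) : rise x n ≠ 0 :=
  rise_ne_zero (fun m => by simpa using hx (-m)) n

lemma rhsRegular_of_ne_int {l : ℕ} {r : ℤ} {a b c : ℝ} (hc : ∀ n : ℕ, 1 - c ≠ -n)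
    (ha : ∀ m : ℤ, a ≠ m) (hb : ∀ m : ℤ, b ≠ m) (hab : ∀ m : ℤ, a - b ≠ m)
    (hac : ∀ m : ℤ, a - c ≠ m) : RhsRegular l r a b c := by
  refine ⟨hc, fun n hn => hb (-n - 1) (by push_cast; linarith), ?_, fun h => ?_, fun k _ => ⟨?_, ?_⟩⟩
  · exact rise_ne_zero_of_forall_int (fun m hm => ha (1 - m) (by push_cast; linarith)) l
  · obtain ⟨n, hn⟩ := Int.eq_ofNat_of_zero_le h
    rw [hn]
    exact rise_ne_zero_of_forall_int hab n
  · exact rise_ne_zero_of_forall_int (fun m hm => hb (1 - m) (by push_cast; linarith)) k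
  · exact rise_ne_zero_of_forall_int
      (fun m hm => hac (1 + l - r - m) (by push_cast; linarith)) k

lemma RhsRegular.rise_ne_zero {l : ℕ} {r : ℤ} {a b c : ℝ} (h : RhsRegular l r a b c) :
    rise (a - l) l ≠ 0 := by
  rw [rise_reflect, show 1 - (a - l) - (l : ℝ) = 1 - a by ring]
  exact mul_ne_zero (pow_ne_zero _ (by norm_num)) h.2.2.1

lemma RhsRegular.add_one_ne {l : ℕ} {r : ℤ} {a b c : ℝ} (h : RhsRegular l r a b c) (m : ℕ) :
    b + 1 ≠ -m :=
  add_comm 1 b ▸ h.2.1 m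

lemma eventually_add_mul_ne_int (x : ℝ) {k : ℝ} (hk : k ≠ 0) :
    ∀ᶠ t in 𝓝[≠] (0 : ℝ), ∀ m : ℤ, x + k * t ≠ m := by
  have hclosed : IsClosed (((↑) : ℤ → ℝ) '' {m | (m : ℝ) ≠ x}) :=
    Int.isClosedEmbedding_coe_real.isClosedMap _ (isClosed_discrete _)
  have hx : ∀ᶠ y in 𝓝 x, y ∉ ((↑) : ℤ → ℝ) '' {m | (m : ℝ) ≠ x} :=
    hclosed.isOpen_compl.mem_nhds (by simp)
  have hcont : Tendsto (fun t : ℝ => x + k * t) (𝓝[≠] 0) (𝓝 x) := by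
    have : Continuous fun t : ℝ => x + k * t := by fun_prop
    simpa using (this.tendsto 0).mono_left nhdsWithin_le_nhds
  filter_upwards [hcont.eventually hx, self_mem_nhdsWithin] with t ht ht0 m hm
  refine ht ⟨m, fun hmx => ?_, hm.symm⟩
  rw [hmx, add_eq_left] at hm
  exact mul_ne_zero hk ht0 hm

/-- The approach is along a line with slopes `1`, `2`, `d` in `a`, `b`, `c`, where `d = 0` if `c`
must stay fixed and `d = 3` otherwise. Then `a`, `b`, `a - b` and `a - c` all have nonzero slope and
avoid the integers for small `t ≠ 0`. -/
lemma mem_closure_regularApproach (l : ℕ) (r : ℤ) (a b c : ℝ) :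
    (a, b, c) ∈ closure (regularApproach l r c) := by
  obtain ⟨d, hd, hc, hac⟩ : ∃ d : ℝ, ((∃ n : ℕ, c = -(n : ℝ)) → d = 0) ∧
      (∀ᶠ t in 𝓝[≠] (0 : ℝ), ∀ n : ℕ, 1 - (c + d * t) ≠ -n) ∧ d ≠ 1 := by
    by_cases h : ∃ n : ℕ, c = -(n : ℝ)
    · refine ⟨0, fun _ => rfl, .of_forall fun t n hn => ?_, zero_ne_one⟩
      obtain ⟨m, rfl⟩ := h
      have h1 : (0 : ℝ) ≤ m := m.cast_nonneg
      have h2 : (0 : ℝ) ≤ n := n.cast_nonneg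
      linarith
    · refine ⟨3, fun h' => (h h').elim, ?_, by norm_num⟩
      filter_upwards [eventually_add_mul_ne_int c (k := 3) (by norm_num)] with t ht n hn
      exact ht (n + 1) (by push_cast; linarith)
  have hlim : Tendsto (fun t : ℝ => (a + 1 * t, b + 2 * t, c + d * t)) (𝓝[≠] 0)
      (𝓝 (a, b, c)) := by
    have : Continuous fun t : ℝ => (a + 1 * t, b + 2 * t, c + d * t) := by fun_prop
    simpa using (this.tendsto 0).mono_left nhdsWithin_le_nhds
  refine mem_closure_of_tendsto hlim ?_
  filter_upwards [hc, eventually_add_mul_ne_int a one_ne_zero,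
    eventually_add_mul_ne_int b two_ne_zero,
    eventually_add_mul_ne_int (a - b) (k := -1) (by norm_num),
    eventually_add_mul_ne_int (a - c) (k := 1 - d) (sub_ne_zero.2 hac.symm)]
    with t h1 h2 h3 h4 h5
  refine ⟨rhsRegular_of_ne_int h1 h2 h3 (fun m hm => h4 m ?_) (fun m hm => h5 m ?_), fun h => ?_⟩
  · rw [← hm]
    ring
  · rw [← hm]
    ring
  · simp [hd h]

/-! ### The limit at indeterminate points -/

lemma rise_ne_zero_of_le {x : ℝ} {k n : ℕ} (hkn : k ≤ n) (h : rise x n ≠ 0) : rise x k ≠ 0 := by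
  obtain ⟨d, rfl⟩ := Nat.exists_eq_add_of_le hkn
  rw [rise_add] at h
  exact left_ne_zero_of_mul h

lemma rise_neg_natCast_eq_zero {n k : ℕ} (h : n < k) : rise (-n) k = 0 := by
  rw [rise_neg_natCast, Nat.descFactorial_of_lt h, Nat.cast_zero, mul_zero]

lemma rise_neg_natCast_self_ne_zero (n : ℕ) : rise (-n) n ≠ 0 := by
  rw [rise_neg_natCast, Nat.descFactorial_self]
  exact mul_ne_zero (pow_ne_zero _ (by norm_num)) (by positivity)

lemma hyp32Term_neg_natCast_eq_zero (a₁ a₂ b₁ b₂ x : ℝ) {n k : ℕ} (h : n < k) :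
    hyp32Term a₁ a₂ (-n) b₁ b₂ x k = 0 := by
  simp [hyp32Term, poch_natCast, rise_neg_natCast_eq_zero h]

lemma hasSum_hyp32Term_neg_natCast (a₁ a₂ b₁ b₂ x : ℝ) (n : ℕ) :
    HasSum (hyp32Term a₁ a₂ (-n) b₁ b₂ x)
      (∑ k ∈ Finset.range (n + 1), hyp32Term a₁ a₂ (-n) b₁ b₂ x k) :=
  hasSum_sum_of_ne_finset_zero fun k hk =>
    hyp32Term_neg_natCast_eq_zero _ _ _ _ _ (by
      have := mt Finset.mem_range.2 hk
      omega)

lemma summable_and_tendsto_gaussExpansion {l : ℕ} {r : ℤ} {a b c : ℝ} (hc : c < r - l + 1)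
    (hdef : ∀ k : ℕ, rise c k ≠ 0 → rise (a - l) k ≠ 0 ∧ rise (b + 1) k ≠ 0) :
    Summable (hyp32Term a (b - r) c (a - l) (b + 1) 1) ∧
    Tendsto (fun p : ℝ × ℝ × ℝ => gaussExpansion l r p.1 p.2.1 p.2.2)
      (𝓝[regularApproach l r c] (a, b, c))
      (𝓝 (hyp32 a (b - r) c (a - l) (b + 1) 1)) := by
  by_cases hcn : ∃ n : ℕ, c = -(n : ℝ)
  · have hfix : ∀ p ∈ regularApproach l r c, p.2.2 = c := fun p hp => hp.2 hcn
    obtain ⟨n, rfl⟩ := hcn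
    have hs := hasSum_hyp32Term_neg_natCast a (b - r) (a - l) (b + 1) 1 n
    refine ⟨hs.summable, ?_⟩
    obtain ⟨han, hbn⟩ := hdef n (rise_neg_natCast_self_ne_zero n)
    have hca : ContinuousAt (fun p : ℝ × ℝ × ℝ => rise (p.1 - l) n) (a, b, -(n : ℝ)) :=
      ((continuous_rise n).comp (by fun_prop : Continuous fun p : ℝ × ℝ × ℝ => p.1 - l)).continuousAt
    have hlim : Tendsto (fun p : ℝ × ℝ × ℝ => ∑ k ∈ Finset.range (n + 1),
        hyp32Term p.1 (p.2.1 - r) (-n) (p.1 - l) (p.2.1 + 1) 1 k)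
        (𝓝 (a, b, -(n : ℝ))) (𝓝 (hyp32 a (b - r) (-n) (a - l) (b + 1) 1)) := by
      rw [show hyp32 a (b - r) (-n) (a - l) (b + 1) 1 = _ from hs.tsum_eq]
      refine tendsto_finsetSum _ fun k hk => ?_
      have hkn : k ≤ n := Nat.lt_succ_iff.1 (Finset.mem_range.1 hk)
      have hrise {f : ℝ × ℝ × ℝ → ℝ} (hf : Continuous f) :
          ContinuousAt (fun p => rise (f p) k) (a, b, -(n : ℝ)) :=
        ((continuous_rise k).comp hf).continuousAt
      simp only [hyp32Term, poch_natCast, one_pow, mul_one]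
      refine ContinuousAt.div (((hrise (by fun_prop)).mul (hrise (by fun_prop))).mul
        continuousAt_const) (((hrise (by fun_prop)).mul (hrise (by fun_prop))).mul
        continuousAt_const) ?_
      exact mul_ne_zero (mul_ne_zero (rise_ne_zero_of_le hkn han) (rise_ne_zero_of_le hkn hbn))
        (by positivity)
    refine (hlim.mono_left nhdsWithin_le_nhds).congr' ?_
    -- Regularity controls only the first `l` factors of `(a' - l)_n`; nearness to `a` supplies the
    -- others.
    filter_upwards [self_mem_nhdsWithin,
      mem_nhdsWithin_of_mem_nhds (hca.eventually_ne han)] with p hp hpa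
    have hpc := hfix p hp
    have h := hasSum_hyp32Term hp.1.rise_ne_zero hp.1.add_one_ne (hpc ▸ hc) fun k hk => ?_
    · rw [hpc] at h ⊢
      exact (hasSum_hyp32Term_neg_natCast _ _ _ _ _ n).unique h
    · refine rise_ne_zero_of_le (not_lt.1 fun hnk => hk ?_) hpa
      rw [hpc, rise_neg_natCast_eq_zero hnk]
  · push Not at hcn
    have hr (k : ℕ) := hdef k (rise_ne_zero hcn k)
    have hb (m : ℕ) : b + 1 ≠ -m := fun hm =>
      (hr (m + 1)).2 ((rise_eq_zero_iff _ _).2 ⟨m, m.lt_succ_self, by linarith⟩)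
    have hs := hasSum_hyp32Term (hr l).1 hb hc fun k _ => (hr k).1
    refine ⟨hs.summable, ?_⟩
    rw [show hyp32 a (b - r) c (a - l) (b + 1) 1 = _ from hs.tsum_eq]
    exact (continuousAt_gaussExpansion (hr l).1 hb hc).tendsto.mono_left nhdsWithin_le_nhds

theorem theorem1 (l : ℕ) (r : ℤ) (a b c : ℝ)
    (hc : c < r - l ∨ ((∃ n : ℕ, c = -(n : ℝ)) ∧ c ≤ r - l))
    -- the left-hand series is well defined: no bottom symbol vanishes before `c` terminates it
    (hdef : ∀ k : ℕ, poch c k ≠ 0 → poch (a - l) k ≠ 0 ∧ poch (b + 1) k ≠ 0) :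
    Summable (hyp32Term a (b - r) c (a - l) (b + 1) 1) ∧
    -- the identity wherever the right-hand side is determinate
    (RhsRegular l r a b c →
      hyp32 a (b - r) c (a - l) (b + 1) 1 = thomaeRhs l r a b c) ∧
    -- the identity as a limit at every other point
    ((a, b, c) ∈ closure (regularApproach l r c) ∧
      Tendsto (fun p : ℝ × ℝ × ℝ => thomaeRhs l r p.1 p.2.1 p.2.2)
        (𝓝[regularApproach l r c] (a, b, c))
        (𝓝 (hyp32 a (b - r) c (a - l) (b + 1) 1))) ∧
    -- both sides vanish for negative `r`
    (r < 0 → hyp32 a (b - r) c (a - l) (b + 1) 1 = 0 ∧ thomaeRhs l r a b c = 0) := by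
  -- The parametric excess `r - l + 1 - c` being positive is all that Gauss's theorem needs.
  have hc' : c < r - l + 1 := by
    rcases hc with h | ⟨-, h⟩ <;> linarith
  simp only [poch_natCast] at hdef
  obtain ⟨hs, hlim⟩ := summable_and_tendsto_gaussExpansion hc' hdef
  have hmem := mem_closure_regularApproach l r a b c
  have hlim' : Tendsto (fun p : ℝ × ℝ × ℝ => thomaeRhs l r p.1 p.2.1 p.2.2)
      (𝓝[regularApproach l r c] (a, b, c)) (𝓝 (hyp32 a (b - r) c (a - l) (b + 1) 1)) :=
    hlim.congr' (eventually_nhdsWithin_of_forall fun p hp => gaussExpansion_eq_thomaeRhs hp.1)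
  refine ⟨hs, fun h => ?_, ⟨hmem, hlim'⟩, fun hr => ⟨?_, thomaeRhs_of_neg hr a b c⟩⟩
  · rw [← gaussExpansion_eq_thomaeRhs h]
    exact (hasSum_hyp32Term h.rise_ne_zero h.add_one_ne hc' fun k hk => (hdef k hk).1).tsum_eq
  -- The approach filter is nontrivial, so the limit of the zero function can only be `0`.
  · have := mem_closure_iff_nhdsWithin_neBot.1 hmem
    simp only [thomaeRhs_of_neg hr] at hlim'
    exact tendsto_nhds_unique hlim' tendsto_const_nhds
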